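/- Let $p$ be a prime. A $p$-element of a profinite group $G$ is an element $g\in G$ such that the closed subgroup topologically generated by $g$ is a pro-$p$ group. Write $[a,b]=a^{-1}b^{-1}ab$, $[x,{}_0g]=x$ and $[x,{}_{n+1}g]=[[x,{}_ng],g]$. An Engel sink of $g\in G$ is a subset $\mathscr{E}\subseteq G$ such that for every $x\in G$ there is a positive integer $l=l(x,g)$ with $[x,{}_ng]\in\mathscr{E}$ for all $n\ge l$. Let $G$ be a profinite group in which every $p$-element has a finite Engel sink. Then $G$ has a closed normal subgroup $N$ such that $N$ is virtually pro-$p$ (that is, $N$ has an open subgroup that is a pro-$p$ group) and $G/N$ is a pro-$p'$ group (that is, every quotient of $G/N$ by an open normal subgroup is a finite group of order prime to $p$). -/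

import Mathlib

/-- A profinite group: a compact, Hausdorff, totally disconnected topological group. -/
structure IsProfiniteGroup (H : Type*) [Group H] [TopologicalSpace H] : Prop where
  isTopologicalGroup : IsTopologicalGroup H
  compactSpace : CompactSpace H
  t2Space : T2Space H
  totallyDisconnectedSpace : TotallyDisconnectedSpace H

/-- A pro-`p` group: a profinite group all of whose quotients by open normal subgroups
(these quotients are finite) are `p`-groups. -/
structure IsProP (p : ℕ) (H : Type*) [Group H] [TopologicalSpace H] : Prop where
  isProfiniteGroup : IsProfiniteGroup H
  isPGroup_quotient : ∀ U : Subgroup H, [U.Normal] → IsOpen (U : Set H) → IsPGroup p (H ⧸ U)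

/-- A pro-`p'` group: a profinite group all of whose quotients by open normal subgroups
(these quotients are finite) have order prime to `p`. -/
structure IsProPPrime (p : ℕ) (H : Type*) [Group H] [TopologicalSpace H] : Prop where
  isProfiniteGroup : IsProfiniteGroup H
  coprime_card_quotient : ∀ U : Subgroup H, [U.Normal] → IsOpen (U : Set H) →
    p.Coprime (Nat.card (H ⧸ U))

/-- A profinite group is virtually pro-`p` if it has an open pro-`p` subgroup. -/
structure IsVirtuallyProP (p : ℕ) (H : Type*) [Group H] [TopologicalSpace H] : Prop where
  isProfiniteGroup : IsProfiniteGroup H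
  exists_open : ∃ V : Subgroup H, IsOpen (V : Set H) ∧ IsProP p V

/-- A `p`-element of a profinite group: an element that topologically generates a pro-`p`
subgroup (its order as a supernatural number is `p ^ n` with `0 ≤ n ≤ ∞`). -/
def IsPElement (p : ℕ) {G : Type*} [Group G] [TopologicalSpace G] [IsTopologicalGroup G]
    (g : G) : Prop :=
  IsProP p (Subgroup.zpowers g).topologicalClosure

/-- The left-normed commutator `[x, g, …, g]` with `g` repeated `n` times, where
`[a, b] = a⁻¹ b⁻¹ a b`. -/
def engelCommutator {G : Type*} [Group G] (x g : G) : ℕ → G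
  | 0 => x
  | n + 1 => (engelCommutator x g n)⁻¹ * g⁻¹ * engelCommutator x g n * g

/-- `E` is a (left) Engel sink of `g`: for every `x`, all sufficiently long commutators
`[x, g, …, g]` lie in `E`. -/
def IsEngelSink {G : Type*} [Group G] (g : G) (E : Set G) : Prop :=
  ∀ x : G, ∃ l : ℕ, 0 < l ∧ ∀ n : ℕ, l ≤ n → engelCommutator x g n ∈ E

/-! Let A be the largest closed normal pro-`p` subgroup of G. A finite Engel sink E of a `p`-element
g meets some open normal subgroup M in at most the identity, so g acts on M as a left Engel element.
In a finite group a left Engel `p`-element lies in the `p`-core (`exists_normal_isPGroup_of_engel`);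
applied in every finite quotient, this gives [M, g] ≤ A (`exists_commutator_mem_profinitePCore`).
Hence every `p`-element of G/A has an open centralizer, that is, a finite conjugacy class, while G/A
has trivial `p`-core.

In such a group Baire's theorem bounds the class sizes on a coset, and comparing with a largest
class there gives an open normal subgroup D without nontrivial `p`-elements
(`exists_isOpen_normal_forall_isProPTorsion_eq_one`). By coprime conjugacy each coset of D contains
at most one class of `p`-elements, so there are finitely many of them, and by Dietzmann's lemma they
generate a finite normal subgroup. Its preimage in G is N: A is open in it, and all `p`-elements of
G lie in it. -/

/-! ### Left Engel `p`-elements of finite groups -/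

section FiniteGroup

variable {H : Type*} [Group H] {p : ℕ}

theorem Sylow.mem_smul_iff_conj_mem {P : Sylow p H} {g x : H} :
    x ∈ g • P ↔ g⁻¹ * x * g ∈ P := by
  rw [← SetLike.mem_coe, Sylow.coe_smul, Set.mem_smul_set_iff_inv_smul_mem]
  simp [← map_inv]

theorem isPGroup_zpowers {g : H} (hg : ∃ k : ℕ, g ^ p ^ k = 1) :
    IsPGroup p (Subgroup.zpowers g) := by
  obtain ⟨k, hk⟩ := hg
  rintro ⟨x, hx⟩
  obtain ⟨n, rfl⟩ := Subgroup.mem_zpowers_iff.1 hx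
  refine ⟨k, Subtype.ext ?_⟩
  rw [SubmonoidClass.coe_pow, OneMemClass.coe_one, ← zpow_natCast, ← zpow_mul, mul_comm,
    zpow_mul, zpow_natCast, hk, one_zpow]

theorem exists_sylow_of_mem_normalizer {S : Set H} {R : Subgroup H} (hR : IsPGroup p R)
    (hSR : S ⊆ R) {a : H} (ha : ∃ k : ℕ, a ^ p ^ k = 1) (haS : a ∈ Subgroup.normalizer S) :
    ∃ Q : Sylow p H, S ⊆ Q ∧ a ∈ Q := by
  have h1 : IsPGroup p (Subgroup.closure S) := hR.to_le ((Subgroup.closure_le _).2 hSR)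
  have h2 : Subgroup.zpowers a ≤ Subgroup.normalizer (Subgroup.closure S : Set H) := by
    rw [Subgroup.zpowers_le]
    exact Subgroup.normalizer_le_normalizer_closure S haS
  obtain ⟨Q, hQ⟩ := (h1.to_sup_of_normal_left' (isPGroup_zpowers ha) h2).exists_le_sylow
  exact ⟨Q, fun x hx => hQ (Subgroup.mem_sup_left (Subgroup.subset_closure hx)),
    hQ (Subgroup.mem_sup_right (Subgroup.mem_zpowers a))⟩

theorem engelCommutator_mem {N : Subgroup H} {x g : H} (hx : x ∈ N) (hg : g ∈ N) (n : ℕ) :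
    engelCommutator x g n ∈ N := by
  induction n with
  | zero => exact hx
  | succ n ih =>
    exact N.mul_mem (N.mul_mem (N.mul_mem (N.inv_mem ih) (N.inv_mem hg)) ih) hg

theorem engelCommutator_mem_of_normal {N : Subgroup H} [hN : N.Normal] {x g : H} (hx : x ∈ N)
    (n : ℕ) : engelCommutator x g n ∈ N := by
  induction n with
  | zero => exact hx
  | succ n ih =>
    have := N.mul_mem (N.inv_mem ih) (hN.conj_mem _ ih g⁻¹)
    simpa [engelCommutator, mul_assoc] using this

theorem engelCommutator_succ_left (x g : H) (n : ℕ) :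
    engelCommutator x g (n + 1) = engelCommutator (x⁻¹ * g⁻¹ * x * g) g n := by
  induction n with
  | zero => rfl
  | succ n ih => rw [engelCommutator, ih]; rfl

theorem map_engelCommutator {K : Type*} [Group K] (f : H →* K) (x g : H) (n : ℕ) :
    f (engelCommutator x g n) = engelCommutator (f x) (f g) n := by
  induction n with
  | zero => rfl
  | succ n ih => simp [engelCommutator, ih]

/-- In a finite `p`-group `P`, a subgroup `K` that does not contain the trace of `T` on `P`
has its own trace normalized by some further element of `T`. -/
theorem exists_mem_normalizer_inter [Finite H] [Fact p.Prime] {T : Set H}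
    (hT : ∀ t ∈ T, ∀ x : H, x * t * x⁻¹ ∈ T) {P K : Subgroup H} (hP : IsPGroup p P)
    (hKP : K ≤ P) (hne : (K : Set H) ∩ T ≠ (P : Set H) ∩ T) :
    ∃ t ∈ T, t ∈ P ∧ t ∉ K ∧ t ∈ Subgroup.normalizer ((K : Set H) ∩ T) := by
  -- Take L maximal between K and P with the same trace on T as K. Normalizers grow in P, so the
  -- normalizer of L in P has a larger trace; an extra element t of it normalizes both L and T,
  -- hence L ∩ T = K ∩ T.
  obtain ⟨L, hL⟩ := (Set.toFinite
    {L : Subgroup H | K ≤ L ∧ L ≤ P ∧ (L : Set H) ∩ T = (K : Set H) ∩ T}).exists_maximal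
    ⟨K, le_rfl, hKP, rfl⟩
  obtain ⟨hKL, hLP, hLT⟩ := hL.prop
  have hlt : L < P := lt_of_le_of_ne hLP (by rintro rfl; exact hne hLT.symm)
  have : Group.IsNilpotent P := hP.isNilpotent
  have hnc := Group.normalizerCondition_of_isNilpotent (G := P) (L.subgroupOf P)
    (lt_top_iff_ne_top.2 fun h => hlt.not_ge (Subgroup.subgroupOf_eq_top.1 h))
  rw [← Subgroup.subgroupOf_normalizer_eq hLP] at hnc
  obtain ⟨x, hx1, hx2⟩ := Set.exists_of_ssubset hnc
  have hx1' : (x : H) ∈ Subgroup.normalizer (L : Set H) := hx1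
  have hx2' : (x : H) ∉ L := hx2
  have hN : ((Subgroup.normalizer (L : Set H) ⊓ P : Subgroup H) : Set H) ∩ T ≠ (K : Set H) ∩ T := by
    intro h
    exact hx2' (hL.le_of_ge ⟨hKL.trans (le_inf Subgroup.le_normalizer hLP), inf_le_right, h⟩
      (le_inf Subgroup.le_normalizer hLP) ⟨hx1', x.2⟩)
  have hsub : (K : Set H) ∩ T ⊆ ((Subgroup.normalizer (L : Set H) ⊓ P : Subgroup H) : Set H) ∩ T :=
    fun y hy => ⟨⟨Subgroup.le_normalizer (hKL hy.1), hKP hy.1⟩, hy.2⟩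
  obtain ⟨t, ⟨⟨ht1, ht2⟩, htT⟩, ht3⟩ := Set.exists_of_ssubset (hsub.ssubset_of_ne hN.symm)
  refine ⟨t, htT, ht2, fun h => ht3 ⟨h, htT⟩, ?_⟩
  rw [← hLT]
  refine Subgroup.mem_normalizer_fintype fun n hn => ⟨(ht1 n).1 hn.1, hT n hn.2 t⟩

/-- A normal set of left Engel `p`-elements meets all Sylow `p`-subgroups in the same set. -/
theorem sylow_inter_eq_of_engel [Finite H] [Fact p.Prime] {T : Set H}
    (hT : ∀ t ∈ T, ∀ x : H, x * t * x⁻¹ ∈ T) (hTp : ∀ t ∈ T, ∃ k : ℕ, t ^ p ^ k = 1)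
    (hE : ∀ t ∈ T, ∀ x : H, ∃ n, engelCommutator x t n = 1) (P Q : Sylow p H) :
    (P : Set H) ∩ T = (Q : Set H) ∩ T := by
  by_contra hPQ
  -- A counterexample with the largest common trace: Sylow subgroups sharing more of T than P and Q
  -- do have equal traces.
  obtain ⟨⟨P, Q⟩, hne, hmax⟩ := Set.exists_max_image
    {x : Sylow p H × Sylow p H | (x.1 : Set H) ∩ T ≠ (x.2 : Set H) ∩ T}
    (fun x => ((x.1 : Set H) ∩ x.2 ∩ T).ncard) (Set.toFinite _) ⟨(P, Q), hPQ⟩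
  simp only [Set.mem_ofPred_eq, Prod.forall] at hne hmax
  set K : Subgroup H := (P : Subgroup H) ⊓ Q with hK
  have hmem (g : H) (R : Sylow p H) (x : H) :
      x ∈ ((g • R : Sylow p H) : Set H) ∩ T ↔ g⁻¹ * x * g ∈ (R : Set H) ∩ T := by
    refine and_congr Sylow.mem_smul_iff_conj_mem ⟨fun h => ?_, fun h => ?_⟩
    · simpa using hT x h g⁻¹
    · simpa [mul_assoc] using hT _ h g
  have hcard : ((P : Set H) ∩ T).ncard = ((Q : Set H) ∩ T).ncard := by
    obtain ⟨g, rfl⟩ := MulAction.exists_smul_eq H P Q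
    rw [← Set.ncard_image_of_injective ((P : Set H) ∩ T) (MulAut.conj g).injective]
    congr 1
    ext x
    rw [hmem, ← MulEquiv.coe_toEquiv, Set.mem_image_equiv]
    simp
  obtain ⟨t, htT, htP, htK, htN⟩ := exists_mem_normalizer_inter hT P.2 inf_le_left
    (show (K : Set H) ∩ T ≠ (P : Set H) ∩ T from fun h =>
      hne (Set.eq_of_subset_of_ncard_le (s := (P : Set H) ∩ T) (t := (Q : Set H) ∩ T)
        (fun x hx => ⟨(h.symm.subset hx).1.2, hx.2⟩) hcard.ge))
  obtain ⟨s, hsT, hsQ, hsK, hsN⟩ := exists_mem_normalizer_inter hT Q.2 inf_le_right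
    (show (K : Set H) ∩ T ≠ (Q : Set H) ∩ T from fun h =>
      hne (Set.eq_of_subset_of_ncard_le (s := (Q : Set H) ∩ T) (t := (P : Set H) ∩ T)
        (fun x hx => ⟨(h.symm.subset hx).1.1, hx.2⟩) hcard.le).symm)
  have hIQ : (K : Set H) ∩ T ⊆ Q := fun x hx => hx.1.2
  have huniq : ∀ R R' : Sylow p H, (K : Set H) ∩ T ⊆ R → (K : Set H) ∩ T ⊆ R' →
      ∀ a ∈ T, a ∈ R → a ∈ R' → a ∉ (K : Set H) ∩ T → (R : Set H) ∩ T = (R' : Set H) ∩ T := by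
    intro R R' hR hR' a haT haR haR' haK
    by_contra hRR
    refine (hmax R R' hRR).not_gt (Set.ncard_lt_ncard ?_)
    exact ⟨fun x hx => ⟨⟨hR hx, hR' hx⟩, hx.2⟩, fun h => haK (h ⟨⟨haR, haR'⟩, haT⟩)⟩
  have hsS : s ∉ (K : Set H) ∩ T := fun h => hsK h.1
  -- A Sylow subgroup containing Q ∩ T and a shares K ∩ T and s with Q, so it has the trace of Q.
  have hmemQ : ∀ a ∈ T, a ∈ Subgroup.normalizer ((Q : Set H) ∩ T) → a ∈ Q := by
    intro a haT haN
    obtain ⟨R, hSR, haR⟩ := exists_sylow_of_mem_normalizer Q.2 Set.inter_subset_left (hTp a haT) haN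
    have := huniq R Q (fun x hx => hSR ⟨hIQ hx, hx.2⟩) hIQ s hsT (hSR ⟨hsQ, hsT⟩) hsQ hsS
    exact (this.subset ⟨haR, haT⟩).1
  -- The conjugate of Q by y shares K ∩ T and y⁻¹sy with Q, so it has the trace of Q.
  have hnorm : ∀ y ∈ Subgroup.normalizer ((K : Set H) ∩ T), y⁻¹ * s * y ∈ Q →
      y ∈ Subgroup.normalizer ((Q : Set H) ∩ T) := by
    intro y hy hyQ
    rw [Subgroup.mem_set_normalizer_iff''] at hy ⊢
    intro h
    rw [← hmem]
    have hys : y⁻¹ * s * y ∈ T := by simpa using hT s hsT y⁻¹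
    have : ((y⁻¹ • Q : Sylow p H) : Set H) ∩ T = (Q : Set H) ∩ T := by
      refine huniq _ _ (fun x hx => ?_) hIQ _ hys ?_ hyQ (fun h => hsS ((hy s).2 h))
      · refine Sylow.mem_smul_iff_conj_mem.2 (hIQ ((hy _).2 ?_))
        simpa [mul_assoc] using hx
      · rw [Sylow.mem_smul_iff_conj_mem]
        simpa [mul_assoc] using show s ∈ Q from hsQ
    have h2 := hmem y⁻¹ Q (y⁻¹ * h * y)
    rw [this] at h2
    rw [hmem, h2]
    simp [mul_assoc]
  have hsNS : s ∈ Subgroup.normalizer ((Q : Set H) ∩ T) :=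
    Subgroup.mem_normalizer_fintype fun n hn =>
      ⟨Q.mul_mem (Q.mul_mem hsQ hn.1) (Q.inv_mem hsQ), hT n hn.2 s⟩
  obtain ⟨n, hn⟩ := hE s hsT t
  -- Descend from [t, s, …, s] = 1. With c = [t, ₖs], the conjugate c⁻¹sc equals s[c, s]⁻¹. If [c,
  -- s] normalizes Q ∩ T, so does this element of T, which therefore lies in Q by `hmemQ`; then c
  -- normalizes Q ∩ T by `hnorm`.
  have hdown : ∀ k, engelCommutator t s k ∈ Subgroup.normalizer ((Q : Set H) ∩ T) →
      t ∈ Subgroup.normalizer ((Q : Set H) ∩ T) := by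
    intro k
    induction k with
    | zero => exact id
    | succ k ih =>
      intro hk
      refine ih (hnorm _ (engelCommutator_mem htN hsN k) (hmemQ _ ?_ ?_))
      · simpa using hT s hsT (engelCommutator t s k)⁻¹
      · have := Subgroup.mul_mem _ hsNS (Subgroup.inv_mem _ hk)
        simpa [engelCommutator, mul_assoc] using this
  exact htK ⟨htP, hmemQ t htT (hdown n (hn ▸ Subgroup.one_mem _))⟩

/-- A left Engel `p`-element of a finite group lies in a normal `p`-subgroup. -/
theorem exists_normal_isPGroup_of_engel [Finite H] [Fact p.Prime] {g : H}
    (hg : ∃ k : ℕ, g ^ p ^ k = 1) (hE : ∀ x : H, ∃ n, engelCommutator x g n = 1) :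
    ∃ B : Subgroup H, B.Normal ∧ IsPGroup p B ∧ g ∈ B := by
  set T : Set H := Set.range fun x : H => x * g * x⁻¹ with hTdef
  have hT : ∀ t ∈ T, ∀ x : H, x * t * x⁻¹ ∈ T := by
    rintro _ ⟨y, rfl⟩ x
    exact ⟨x * y, by simp [mul_assoc]⟩
  have hTp : ∀ t ∈ T, ∃ k : ℕ, t ^ p ^ k = 1 := by
    rintro _ ⟨y, rfl⟩
    obtain ⟨k, hk⟩ := hg
    exact ⟨k, by simp [conj_pow, hk]⟩
  have hTE : ∀ t ∈ T, ∀ x : H, ∃ n, engelCommutator x t n = 1 := by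
    rintro _ ⟨y, rfl⟩ x
    obtain ⟨n, hn⟩ := hE (y⁻¹ * x * y)
    refine ⟨n, ?_⟩
    have := map_engelCommutator (MulAut.conj y).toMonoidHom (y⁻¹ * x * y) g n
    rw [hn, map_one] at this
    simpa [mul_assoc] using this.symm
  obtain ⟨P⟩ : Nonempty (Sylow p H) := inferInstance
  have hTP : T ⊆ P := by
    intro t ht
    obtain ⟨Q, hQ⟩ := (isPGroup_zpowers (hTp t ht)).exists_le_sylow
    exact ((sylow_inter_eq_of_engel hT hTp hTE Q P).subset
      ⟨hQ (Subgroup.mem_zpowers t), ht⟩).1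
  refine ⟨Subgroup.closure T, ?_, P.2.to_le ((Subgroup.closure_le _).2 hTP),
    Subgroup.subset_closure ⟨1, by simp⟩⟩
  rw [← Subgroup.normalizer_eq_top_iff, eq_top_iff]
  refine le_trans (fun x _ => ?_) (Subgroup.normalizer_le_normalizer_closure T)
  exact Subgroup.mem_normalizer_fintype fun n hn => hT n hn x

end FiniteGroup

/-! ### The `p`-core and Engel action on a normal subgroup -/

section PCore

variable {H : Type*} [Group H] {p : ℕ}

/-- The `p`-core of a group: the union of its normal `p`-subgroups. -/
def pCore (p : ℕ) (H : Type*) [Group H] : Subgroup H where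
  carrier := {y | ∃ B : Subgroup H, B.Normal ∧ IsPGroup p B ∧ y ∈ B}
  one_mem' := ⟨⊥, inferInstance, IsPGroup.of_bot, Subgroup.one_mem _⟩
  mul_mem' := by
    rintro a b ⟨A, hA, hA', ha⟩ ⟨B, hB, hB', hb⟩
    exact ⟨A ⊔ B, inferInstance, hA'.to_sup_of_normal_right hB', Subgroup.mul_mem_sup ha hb⟩
  inv_mem' := by
    rintro a ⟨A, hA, hA', ha⟩
    exact ⟨A, hA, hA', A.inv_mem ha⟩

theorem isPGroup_pCore : IsPGroup p (pCore p H) := by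
  rintro ⟨y, B, _, hB, hy⟩
  obtain ⟨k, hk⟩ := hB ⟨y, hy⟩
  exact ⟨k, Subtype.ext (by simpa using congrArg Subtype.val hk)⟩

instance pCore_characteristic : (pCore p H).Characteristic := by
  rw [Subgroup.characteristic_iff_map_le]
  rintro φ _ ⟨y, ⟨B, hB, hB', hy⟩, rfl⟩
  exact ⟨B.map φ.toMonoidHom, hB.map _ φ.surjective, hB'.map _, Subgroup.mem_map_of_mem _ hy⟩

/-- If a `p`-element `g` of a finite group acts on a normal subgroup `M` as an Engel element,
then `[M, g]` lies in the `p`-core. -/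
theorem commutator_mem_pCore_of_engel [Finite H] [Fact p.Prime] {M : Subgroup H} [hM : M.Normal]
    {g : H} (hg : ∃ k : ℕ, g ^ p ^ k = 1) (hE : ∀ x ∈ M, ∃ n, engelCommutator x g n = 1)
    {x : H} (hx : x ∈ M) : x⁻¹ * g⁻¹ * x * g ∈ pCore p H := by
  set K := M ⊔ Subgroup.zpowers g with hK
  have hMK : M ≤ K := le_sup_left
  have hgK : g ∈ K := (le_sup_right : Subgroup.zpowers g ≤ K) (Subgroup.mem_zpowers g)
  -- Since [K, g] ≤ M, being Engel on M makes g left Engel in all of K = M⟨g⟩.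
  have hcomm : ∀ x ∈ K, x⁻¹ * g⁻¹ * x * g ∈ M := by
    intro x hx
    obtain ⟨y, hy, z, hz, rfl⟩ := Subgroup.mem_sup_of_normal_left.1 hx
    obtain ⟨n, rfl⟩ := Subgroup.mem_zpowers_iff.1 hz
    have h1 := M.mul_mem (M.inv_mem hy) (hM.conj_mem _ hy g⁻¹)
    have h2 := hM.conj_mem _ h1 (g ^ n)⁻¹
    have h3 : g ^ n * g = g * g ^ n := ((Commute.refl g).zpow_left n).eq
    simpa [mul_assoc, h3] using h2
  obtain ⟨B, hB, hBp, hgB⟩ := exists_normal_isPGroup_of_engel (p := p) (g := (⟨g, hgK⟩ : K))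
    (by obtain ⟨k, hk⟩ := hg; exact ⟨k, Subtype.ext hk⟩) (by
      intro y
      obtain ⟨n, hn⟩ := hE _ (hcomm y y.2)
      refine ⟨n + 1, Subtype.ext ?_⟩
      have := map_engelCommutator K.subtype y ⟨g, hgK⟩ (n + 1)
      exact this.trans ((engelCommutator_succ_left _ _ _).trans hn))
  have hxm : x⁻¹ * g⁻¹ * x * g ∈ M := hcomm x (hMK hx)
  have hxB : x⁻¹ * g⁻¹ * x * g ∈ B.map K.subtype := by
    refine ⟨(⟨x, hMK hx⟩ : K)⁻¹ * (⟨g, hgK⟩ : K)⁻¹ * ⟨x, hMK hx⟩ * ⟨g, hgK⟩, ?_, rfl⟩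
    refine B.mul_mem ?_ hgB
    simpa using hB.conj_mem _ (B.inv_mem hgB) (⟨x, hMK hx⟩ : K)⁻¹
  -- B ∩ M is a normal `p`-subgroup of M, and the `p`-core of M is characteristic in M, hence normal
  -- in H.
  have hmem : (⟨_, hxm⟩ : M) ∈ pCore p M := by
    refine ⟨(B.map K.subtype).comap M.subtype, ⟨?_⟩, (hBp.map _).comap_subtype, hxB⟩
    rintro n ⟨b, hb, hbn⟩ m
    exact ⟨⟨m, hMK m.2⟩ * b * (⟨m, hMK m.2⟩ : K)⁻¹, hB.conj_mem b hb _, by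
      simp only [map_mul, map_inv, hbn]; rfl⟩
  exact ⟨(pCore p M).map M.subtype, inferInstance, isPGroup_pCore.map _, _, hmem, rfl⟩

end PCore

/-! ### Elements of `p`-power order in all finite quotients -/

section ProfiniteTorsion

variable {G : Type*} [Group G] [TopologicalSpace G]

/-- An element whose image in every quotient by an open normal subgroup is a `p`-element. -/
def IsProPTorsion (p : ℕ) (g : G) : Prop :=
  ∀ N : Subgroup G, N.Normal → IsOpen (N : Set G) → ∃ k : ℕ, g ^ p ^ k ∈ N

variable {p : ℕ} {g : G}

theorem IsProPTorsion.conj (hg : IsProPTorsion p g) (x : G) : IsProPTorsion p (x * g * x⁻¹) := by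
  intro N hN hNo
  obtain ⟨k, hk⟩ := hg N hN hNo
  exact ⟨k, by rw [conj_pow]; exact hN.conj_mem _ hk x⟩

theorem IsProPTorsion.mul {g' : G} (hg : IsProPTorsion p g) (hg' : IsProPTorsion p g')
    (h : Commute g g') : IsProPTorsion p (g * g') := by
  intro N hN hNo
  obtain ⟨k, hk⟩ := hg N hN hNo
  obtain ⟨l, hl⟩ := hg' N hN hNo
  refine ⟨k + l, ?_⟩
  rw [h.mul_pow, pow_add, pow_mul, mul_comm, pow_mul g']
  exact N.mul_mem (N.pow_mem hk _) (N.pow_mem hl _)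

theorem IsProPTorsion.inv (hg : IsProPTorsion p g) : IsProPTorsion p g⁻¹ := by
  intro N hN hNo
  obtain ⟨k, hk⟩ := hg N hN hNo
  exact ⟨k, by rw [inv_pow]; exact N.inv_mem hk⟩

theorem IsProPTorsion.pow (hg : IsProPTorsion p g) (n : ℕ) : IsProPTorsion p (g ^ n) := by
  intro N hN hNo
  obtain ⟨k, hk⟩ := hg N hN hNo
  exact ⟨k, by rw [← pow_mul, mul_comm, pow_mul]; exact N.pow_mem hk _⟩

theorem isProPTorsion_one : IsProPTorsion p (1 : G) :=
  fun N _ _ => ⟨0, by simp⟩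

theorem IsProPTorsion.zpow (hg : IsProPTorsion p g) (n : ℤ) : IsProPTorsion p (g ^ n) := by
  obtain ⟨k, rfl | rfl⟩ := n.eq_nat_or_neg
  · simpa using hg.pow k
  · simpa using (hg.pow k).inv

/-- A compactness principle: closed conditions indexed by the open normal subgroups that are
antitone and each satisfiable are simultaneously satisfiable. -/
theorem exists_forall_isOpen_normal [CompactSpace G] (S : Subgroup G → Set G)
    (hmono : ∀ N N' : Subgroup G, N ≤ N' → S N ⊆ S N')
    (hclosed : ∀ N : Subgroup G, N.Normal → IsOpen (N : Set G) → IsClosed (S N))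
    (hne : ∀ N : Subgroup G, N.Normal → IsOpen (N : Set G) → (S N).Nonempty) :
    ∃ x, ∀ N : Subgroup G, N.Normal → IsOpen (N : Set G) → x ∈ S N := by
  have hι : Nonempty {N : Subgroup G // N.Normal ∧ IsOpen (N : Set G)} :=
    ⟨⊤, inferInstance, isOpen_univ⟩
  obtain ⟨x, hx⟩ := IsCompact.nonempty_iInter_of_directed_nonempty_isCompact_isClosed
    (fun N : {N : Subgroup G // N.Normal ∧ IsOpen (N : Set G)} => S N)
    (fun N N' => ⟨⟨N.1 ⊓ N'.1, by
        have := N.2.1; have := N'.2.1; infer_instance, N.2.2.inter N'.2.2⟩,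
      hmono _ _ inf_le_left, hmono _ _ inf_le_right⟩)
    (fun N => hne N N.2.1 N.2.2) (fun N => (hclosed N N.2.1 N.2.2).isCompact)
    (fun N => hclosed N N.2.1 N.2.2)
  exact ⟨x, fun N hN hNo => Set.mem_iInter.1 hx ⟨N, hN, hNo⟩⟩

variable [IsTopologicalGroup G]

theorem isClopen_preimage_mk {N : Subgroup G} (hN : IsOpen (N : Set G)) (S : Set (G ⧸ N)) :
    IsClopen ((QuotientGroup.mk : G → G ⧸ N) ⁻¹' S) := by
  have := QuotientGroup.discreteTopology hN
  exact (isClopen_discrete S).preimage QuotientGroup.continuous_mk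

theorem isClosed_setOf_exists_pow_mem {N : Subgroup G} [N.Normal] (hN : IsOpen (N : Set G)) :
    IsClosed {g : G | ∃ k : ℕ, g ^ p ^ k ∈ N} := by
  convert (isClopen_preimage_mk hN {x | ∃ k : ℕ, x ^ p ^ k = 1}).isClosed using 1
  ext g
  simp [← QuotientGroup.mk_pow]

theorem isClosed_setOf_isProPTorsion : IsClosed {g : G | IsProPTorsion p g} := by
  have : {g : G | IsProPTorsion p g} = ⋂ (N : Subgroup G) (_ : N.Normal) (_ : IsOpen (N : Set G)),
      {g : G | ∃ k : ℕ, g ^ p ^ k ∈ N} := by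
    ext g
    simp [IsProPTorsion]
  rw [this]
  refine isClosed_iInter fun N => isClosed_iInter fun hN => isClosed_iInter fun hNo => ?_
  exact isClosed_setOf_exists_pow_mem hNo

variable [CompactSpace G]

theorem finite_quotient_of_isOpen {N : Subgroup G} (hN : IsOpen (N : Set G)) : Finite (G ⧸ N) :=
  N.quotient_finite_of_isOpen hN

/-- A `p`-element modulo an open normal subgroup lifts to an element that is a `p`-element
modulo every open normal subgroup. -/
theorem exists_isProPTorsion_of_pow_mem (hp : p.Prime) {K : Subgroup G} (hK : K.Normal)
    (hKo : IsOpen (K : Set G)) {d : G} {k : ℕ} (hd : d ^ p ^ k ∈ K) :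
    ∃ d' : G, IsProPTorsion p d' ∧ d⁻¹ * d' ∈ K := by
  suffices h : ∃ x : G, ∀ N : Subgroup G, N.Normal → IsOpen (N : Set G) →
      x ∈ {x : G | d⁻¹ * x ∈ K ∧ ∃ k : ℕ, x ^ p ^ k ∈ N} by
    obtain ⟨x, hx⟩ := h
    exact ⟨x, fun N hN hNo => (hx N hN hNo).2, (hx K hK hKo).1⟩
  refine exists_forall_isOpen_normal _
    (fun N N' h x hx => ⟨hx.1, hx.2.imp fun _ hk => h hk⟩) ?_ ?_
  · intro N hN hNo
    refine IsClosed.inter ?_ ?_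
    · exact (Subgroup.isClosed_of_isOpen K hKo).preimage (continuous_const_mul d⁻¹)
    · exact isClosed_setOf_exists_pow_mem hNo
  · intro N hN hNo
    have := finite_quotient_of_isOpen hNo
    obtain ⟨a, b, hb, hcard⟩ := Nat.exists_eq_pow_mul_and_not_dvd
      (Nat.card_pos (α := G ⧸ N)).ne' p hp.ne_one
    have hcop : Nat.Coprime (p ^ k) b := ((Nat.Prime.coprime_iff_not_dvd hp).2 hb).pow_left k
    -- With |G/N| = p^a b, the exponent e ≡ 1 mod p^k leaves d unchanged modulo K, and e ≡ 0 mod b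
    -- removes the `p'`-part modulo N.
    obtain ⟨e, he1, he2⟩ := Nat.chineseRemainder hcop 1 0
    refine ⟨d ^ e, ?_, a, ?_⟩
    · have h1 : (d : G ⧸ K) ^ e = d := by
        have h2 : (d : G ⧸ K) ^ p ^ k = 1 := by
          rw [← QuotientGroup.mk_pow]; exact (QuotientGroup.eq_one_iff _).2 hd
        have h3 := pow_eq_pow_iff_modEq.2 (he1.of_dvd (orderOf_dvd_of_pow_eq_one h2))
        rwa [pow_one] at h3
      rw [← QuotientGroup.mk_pow] at h1
      exact QuotientGroup.eq.1 h1.symm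
    · obtain ⟨c, rfl⟩ := (Nat.modEq_zero_iff_dvd.1 he2)
      rw [← QuotientGroup.eq_one_iff, ← pow_mul, mul_right_comm, mul_comm b, ← hcard,
        QuotientGroup.mk_pow, pow_mul, pow_card_eq_one', one_pow]

variable [TotallyDisconnectedSpace G]

theorem exists_isOpen_normal_subset {U : Set G} (hU : IsOpen U) (h1 : 1 ∈ U) :
    ∃ N : Subgroup G, N.Normal ∧ IsOpen (N : Set G) ∧ (N : Set G) ⊆ U := by
  obtain ⟨N, hN⟩ := ProfiniteGrp.exist_openNormalSubgroup_sub_open_nhds_of_one hU h1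
  exact ⟨N.toSubgroup, N.isNormal', N.isOpen', hN⟩

theorem eq_one_of_forall_mem_isOpen_normal [T2Space G] {x : G}
    (h : ∀ N : Subgroup G, N.Normal → IsOpen (N : Set G) → x ∈ N) : x = 1 := by
  by_contra hx
  obtain ⟨N, hN, hNo, hNx⟩ := exists_isOpen_normal_subset (U := {x}ᶜ) isOpen_compl_singleton
    (by simpa [eq_comm] using hx)
  exact hNx (h N hN hNo) rfl

theorem exists_isOpen_normal_le {C : Subgroup G} (hC : IsOpen (C : Set G)) :
    ∃ N : Subgroup G, N.Normal ∧ IsOpen (N : Set G) ∧ N ≤ C :=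
  exists_isOpen_normal_subset hC C.one_mem

theorem isProP_of_forall_isProPTorsion [T2Space G] {B : Subgroup G} (hB : IsClosed (B : Set G))
    (h : ∀ b ∈ B, IsProPTorsion p b) : IsProP p B := by
  refine ⟨⟨inferInstance, isCompact_iff_compactSpace.1 hB.isCompact, inferInstance,
    inferInstance⟩, fun U _ hU x => ?_⟩
  obtain ⟨b, rfl⟩ := QuotientGroup.mk_surjective x
  obtain ⟨V, hV, hVU⟩ := isOpen_induced_iff.1 hU
  have h1 : (1 : B) ∈ Subtype.val ⁻¹' V := hVU ▸ U.one_mem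
  obtain ⟨N, hN, hNo, hNV⟩ := exists_isOpen_normal_subset hV h1
  obtain ⟨k, hk⟩ := h b b.2 N hN hNo
  refine ⟨k, ?_⟩
  rw [← QuotientGroup.mk_pow, QuotientGroup.eq_one_iff, ← SetLike.mem_coe, ← hVU]
  exact hNV hk

/-- The condition is closed and passes to powers, so it holds on the closure of ⟨g⟩. Only this
direction is needed, to feed the hypothesis on sinks. -/
theorem IsProPTorsion.isPElement [T2Space G] (hg : IsProPTorsion p g) : IsPElement p g := by
  refine isProP_of_forall_isProPTorsion (Subgroup.isClosed_topologicalClosure _) fun b hb => ?_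
  refine closure_minimal (t := {g : G | IsProPTorsion p g}) ?_ isClosed_setOf_isProPTorsion hb
  intro x hx
  obtain ⟨n, rfl⟩ := Subgroup.mem_zpowers_iff.1 hx
  exact hg.zpow n

end ProfiniteTorsion

/-! ### Dietzmann's lemma -/

section Dietzmann

variable {H : Type*} [Group H]

/-- A commutator depends only on the cosets of its two entries modulo the center. -/
theorem finite_commutatorSet_of_finiteIndex_center [(Subgroup.center H).FiniteIndex] :
    Finite (commutatorSet H) := by
  refine Set.Finite.to_subtype (Set.Finite.subset (Set.finite_range
    fun q : (H ⧸ Subgroup.center H) × (H ⧸ Subgroup.center H) =>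
      q.1.out * q.2.out * q.1.out⁻¹ * q.2.out⁻¹) ?_)
  rintro _ ⟨a, b, rfl⟩
  refine ⟨(a, b), ?_⟩
  obtain ⟨⟨z, hz⟩, ha⟩ := QuotientGroup.mk_out_eq_mul (Subgroup.center H) a
  obtain ⟨⟨w, hw⟩, hb⟩ := QuotientGroup.mk_out_eq_mul (Subgroup.center H) b
  simp only [ha, hb]
  rw [Subgroup.mem_center_iff] at hz hw
  simp only [commutatorElement_def, mul_inv_rev, mul_assoc]
  rw [← mul_assoc z b, ← hz b, mul_assoc b, ← mul_assoc z w, ← hz w, mul_assoc w, ← mul_assoc z z⁻¹,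
    mul_inv_cancel, one_mul, ← mul_assoc w a⁻¹, ← hw a⁻¹, mul_assoc a⁻¹, ← mul_assoc w w⁻¹,
    mul_inv_cancel, one_mul]

/-- Dietzmann's lemma: a finite normal set of elements of finite order generates a finite
subgroup. -/
theorem finite_closure_of_finite_of_isOfFinOrder {X : Set H} (hX : X.Finite)
    (hconj : ∀ t ∈ X, ∀ x : H, x * t * x⁻¹ ∈ X) (hord : ∀ t ∈ X, IsOfFinOrder t) :
    Finite (Subgroup.closure X) := by
  set N := Subgroup.closure X with hN
  have hgen : Subgroup.closure ((↑) ⁻¹' X : Set N) = ⊤ := Subgroup.closure_closure_coe_preimage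
  have hfin : ((↑) ⁻¹' X : Set N).Finite := hX.preimage Subtype.val_injective.injOn
  have : Group.FG N := Group.fg_iff.2 ⟨_, hgen, hfin⟩
  -- The kernel of the conjugation action of N on the finite generating set X is central.
  have hcen : (Subgroup.center N).FiniteIndex := by
    have : Finite X := hX
    let φ : N →* Equiv.Perm X :=
      { toFun := fun n =>
          { toFun := fun x => ⟨n * x * (n : H)⁻¹, hconj x x.2 n⟩
            invFun := fun x => ⟨(n : H)⁻¹ * x * n, by simpa using hconj x x.2 (n : H)⁻¹⟩
            left_inv := fun x => by simp [mul_assoc]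
            right_inv := fun x => by simp [mul_assoc] }
        map_one' := by ext; simp
        map_mul' := fun a b => by ext; simp [mul_assoc] }
    refine Subgroup.finiteIndex_of_le (H := φ.ker) fun n hn => ?_
    have h1 : N ≤ Subgroup.centralizer {(n : H)} := by
      refine (Subgroup.closure_le _).2 ?_
      intro x hx
      rw [SetLike.mem_coe, Subgroup.mem_centralizer_singleton_iff]
      have := congrArg Subtype.val (DFunLike.congr_fun (MonoidHom.mem_ker.1 hn) ⟨x, hx⟩)
      have h2 : (n : H) * x * (n : H)⁻¹ = x := this
      rw [mul_inv_eq_iff_eq_mul] at h2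
      exact h2.symm
    rw [Subgroup.mem_center_iff]
    exact fun m => Subtype.ext (Subgroup.mem_centralizer_singleton_iff.1 (h1 m.2))
  -- Schur's theorem then makes the derived subgroup finite; the abelianization is finitely
  -- generated and torsion.
  have : Finite (commutatorSet N) := finite_commutatorSet_of_finiteIndex_center
  have hab : Finite (Abelianization N) := by
    have : Group.FG (Abelianization N) := QuotientGroup.fg _
    refine CommGroup.finite_of_fg_isMulTorsion _ fun a => ?_
    obtain ⟨n, rfl⟩ := QuotientGroup.mk_surjective a
    have hn : n ∈ Subgroup.closure ((↑) ⁻¹' X : Set N) := hgen ▸ Subgroup.mem_top n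
    induction hn using Subgroup.closure_induction with
    | mem x hx =>
      exact (Abelianization.of (G := N)).isOfFinOrder (Submonoid.isOfFinOrder_coe.1 (hord _ hx))
    | one => exact IsOfFinOrder.one
    | mul x y _ _ hx hy => exact (Commute.all _ _).isOfFinOrder_mul hx hy
    | inv x _ hx => exact hx.inv
  have : Finite (N ⧸ commutator N) := hab
  exact Finite.of_subgroup_quotient (commutator N)

end Dietzmann

/-! ### Coprime conjugacy, and bounded classes by Baire category -/

section TrivialPCore

variable {G : Type*} [Group G] {p : ℕ}

/-- The map x ↦ g'xg⁻¹ permutes D with `p`-power order, and |D| is prime to `p`, so it has a fixed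
point; a fixed point conjugates g to g'. -/
theorem exists_conj_eq_of_coprime [Finite G] [Fact p.Prime] {D : Subgroup G} [hD : D.Normal]
    (hDp : ¬ p ∣ Nat.card D) {g g' : G} (hg : ∃ k : ℕ, g ^ p ^ k = 1)
    (hg' : ∃ k : ℕ, g' ^ p ^ k = 1) (hgg' : g⁻¹ * g' ∈ D) : ∃ d ∈ D, g' = d * g * d⁻¹ := by
  have h1 : g' * g⁻¹ ∈ D := by simpa [mul_assoc] using hD.conj_mem _ hgg' g
  have h2 : ∀ x ∈ D, g' * x * g⁻¹ ∈ D := fun x hx => by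
    simpa [mul_assoc] using D.mul_mem h1 (hD.conj_mem _ hx g)
  have h3 : ∀ x ∈ D, g'⁻¹ * x * g ∈ D := fun x hx => by
    simpa [mul_assoc] using hD.conj_mem _ (D.mul_mem (D.inv_mem h1) hx) g⁻¹
  let σ : Equiv.Perm D :=
    { toFun := fun x => ⟨g' * x * g⁻¹, h2 x x.2⟩
      invFun := fun x => ⟨g'⁻¹ * x * g, h3 x x.2⟩
      left_inv := fun x => by simp [mul_assoc]
      right_inv := fun x => by simp [mul_assoc] }
  have hσ : ∀ (n : ℕ) (x : D), ((σ ^ n) x : G) = g' ^ n * x * (g ^ n)⁻¹ := by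
    intro n
    induction n with
    | zero => simp
    | succ n ih =>
      intro x
      rw [pow_succ, Equiv.Perm.mul_apply, ih]
      simp [σ, pow_succ, mul_assoc]
  obtain ⟨k, hk⟩ := hg
  obtain ⟨l, hl⟩ := hg'
  have := Fintype.ofFinite D
  obtain ⟨x, hx⟩ := Equiv.Perm.exists_fixed_point_of_prime (p := p) (n := k + l) (σ := σ)
    (by rwa [← Nat.card_eq_fintype_card]) (by
      ext x
      rw [hσ, pow_add, pow_mul g, hk, mul_comm, pow_mul g', hl]
      simp)
  have hx' : g' * x * g⁻¹ = x := congrArg Subtype.val hx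
  exact ⟨x, x.2, by rw [mul_inv_eq_iff_eq_mul] at hx'; rw [← hx']; simp⟩

variable [TopologicalSpace G] [IsTopologicalGroup G] [CompactSpace G]

/-- By the Baire category theorem, if all the pro-`p` torsion elements have finite conjugacy
classes, then these have bounded sizes on some coset of an open normal subgroup. -/
theorem exists_forall_index_centralizer_le [T2Space G] [TotallyDisconnectedSpace G]
    (hC : ∀ g : G, IsProPTorsion p g → IsOpen (Subgroup.centralizer {g} : Set G)) :
    ∃ (m : ℕ) (g : G) (M : Subgroup G), IsProPTorsion p g ∧ M.Normal ∧ IsOpen (M : Set G) ∧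
      ∀ u, IsProPTorsion p u → g⁻¹ * u ∈ M → (Subgroup.centralizer {u}).index ≤ m := by
  let X := {g : G // IsProPTorsion p g}
  have : CompactSpace X := isCompact_iff_compactSpace.1 isClosed_setOf_isProPTorsion.isCompact
  have : Nonempty X := ⟨⟨1, isProPTorsion_one⟩⟩
  -- Class size at most m, expressed as a coincidence among any m + 1 conjugates so that the set is
  -- visibly closed.
  let F : ℕ → Set X := fun m => {u | ∀ y : Fin (m + 1) → G,
    ∃ i j, i ≠ j ∧ y i * u * (y i)⁻¹ = y j * u * (y j)⁻¹}
  have hFc : ∀ m, IsClosed (F m) := by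
    intro m
    have : F m = ⋂ y : Fin (m + 1) → G, ⋃ i, ⋃ j, ⋃ (_ : i ≠ j),
        {u : X | y i * u * (y i)⁻¹ = y j * u * (y j)⁻¹} := by
      ext u
      simp [F]
    rw [this]
    refine isClosed_iInter fun y => isClosed_iUnion_of_finite fun i =>
      isClosed_iUnion_of_finite fun j => isClosed_iUnion_of_finite fun _ => ?_
    exact isClosed_eq (by fun_prop) (by fun_prop)
  have hconj : ∀ u x y : G, x * u * x⁻¹ = y * u * y⁻¹ ↔
      (x : G ⧸ Subgroup.centralizer {u}) = y := by
    intro u x y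
    rw [QuotientGroup.eq, Subgroup.mem_centralizer_singleton_iff]
    constructor
    · intro h
      have := congrArg (fun z => y⁻¹ * z * x) h
      simp only [mul_assoc, inv_mul_cancel, mul_one, inv_mul_cancel_left] at this
      have h3 : y⁻¹ * x * u = u * (y⁻¹ * x) := by simpa [mul_assoc] using this
      have h4 := congrArg (fun z => (y⁻¹ * x)⁻¹ * z * (y⁻¹ * x)⁻¹) h3
      simpa [mul_assoc] using h4.symm
    · intro h
      have := congrArg (fun z => x * z * y⁻¹) h
      simpa [mul_assoc] using this.symm
  have hFu : ⋃ m, F m = Set.univ := by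
    refine Set.eq_univ_of_forall fun u => Set.mem_iUnion.2
      ⟨(Subgroup.centralizer {(u : G)}).index, fun y => ?_⟩
    have := finite_quotient_of_isOpen (hC u u.2)
    have := Fintype.ofFinite (G ⧸ Subgroup.centralizer {(u : G)})
    obtain ⟨i, j, hij, h⟩ := Fintype.exists_ne_map_eq_of_card_lt
      (fun i => (y i : G ⧸ Subgroup.centralizer {(u : G)})) (by
        rw [← Nat.card_eq_fintype_card, Fintype.card_fin]
        exact Nat.lt_succ_self _)
    exact ⟨i, j, hij, (hconj _ _ _).2 h⟩
  obtain ⟨m, g, hg⟩ := nonempty_interior_of_iUnion_of_closed hFc hFu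
  obtain ⟨V, hV, hVF⟩ := isOpen_induced_iff.1 (isOpen_interior (s := F m))
  have hgV : (g : G) ∈ V := by
    have : g ∈ Subtype.val ⁻¹' V := hVF ▸ hg
    exact this
  obtain ⟨M, hM, hMo, hMV⟩ := exists_isOpen_normal_subset (U := {x | (g : G) * x ∈ V})
    (hV.preimage (continuous_const_mul (g : G))) (by simpa using hgV)
  refine ⟨m, g, M, g.2, hM, hMo, fun u hu huM => ?_⟩
  have huF : (⟨u, hu⟩ : X) ∈ F m := by
    refine interior_subset (hVF ▸ ?_ : (⟨u, hu⟩ : X) ∈ interior (F m))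
    simpa using hMV huM
  by_contra! hlt
  have := finite_quotient_of_isOpen (hC u hu)
  have hcard : m + 1 ≤ Nat.card (G ⧸ Subgroup.centralizer {u}) := hlt
  let e := Finite.equivFin (G ⧸ Subgroup.centralizer {u})
  obtain ⟨i, j, hij, h⟩ := huF fun i => (e.symm (Fin.castLE hcard i)).out
  rw [hconj] at h
  simp only [QuotientGroup.out_eq'] at h
  exact hij (Fin.castLE_injective hcard (e.symm.injective h))

end TrivialPCore

/-! ### Finite classes and trivial `p`-core force finitely many `p`-elements -/

section TrivialPCore

variable {G : Type*} [Group G] {p : ℕ} [TopologicalSpace G] [IsTopologicalGroup G] [CompactSpace G]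

theorem finite_range_conj {u : G} (hu : IsOpen (Subgroup.centralizer {u} : Set G)) :
    (Set.range fun y : G => y * u * y⁻¹).Finite := by
  have := finite_quotient_of_isOpen hu
  refine (Set.finite_range fun q : G ⧸ Subgroup.centralizer {u} =>
    q.out * u * q.out⁻¹).subset ?_
  rintro _ ⟨y, rfl⟩
  refine ⟨y, ?_⟩
  obtain ⟨⟨z, hz⟩, h⟩ := QuotientGroup.mk_out_eq_mul (Subgroup.centralizer {u}) y
  rw [Subgroup.mem_centralizer_singleton_iff] at hz
  simp only [h]
  rw [mul_assoc y, hz]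
  group

/-- An element of order `p` in the image would lift, modulo N ∩ D, to a pro-`p` torsion element of
D, which is trivial. Intersecting with D keeps the lift inside D. -/
theorem not_dvd_card_map_mk [Fact p.Prime] {D : Subgroup G} (hDn : D.Normal)
    (hDo : IsOpen (D : Set G)) (hD : ∀ d ∈ D, IsProPTorsion p d → d = 1) (N : Subgroup G)
    [hN : N.Normal] (hNo : IsOpen (N : Set G)) :
    ¬ p ∣ Nat.card (D.map (QuotientGroup.mk' N)) := by
  intro hdvd
  have := finite_quotient_of_isOpen hNo
  obtain ⟨⟨y, hy⟩, hx⟩ := exists_prime_orderOf_dvd_card' p hdvd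
  obtain ⟨d, hd, rfl⟩ := Subgroup.mem_map.1 hy
  have hp : p.Prime := Fact.out
  have h1 : orderOf (QuotientGroup.mk' N d) = p := by
    rw [← hx, Subgroup.orderOf_mk]
  have h2 : d ^ p ^ 1 ∈ N ⊓ D := by
    refine Subgroup.mem_inf.2 ⟨?_, D.pow_mem hd _⟩
    rw [pow_one, ← QuotientGroup.eq_one_iff]
    have := pow_orderOf_eq_one (QuotientGroup.mk' N d)
    rwa [h1] at this
  obtain ⟨d', hd', hdd'⟩ := exists_isProPTorsion_of_pow_mem hp inferInstance (hNo.inter hDo) h2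
  have h3 : d' ∈ D := by simpa using D.mul_mem hd hdd'.2
  rw [hD d' h3 hd', mul_one] at hdd'
  have h4 : QuotientGroup.mk' N d = 1 := (QuotientGroup.eq_one_iff _).2 (by simpa using hdd'.1)
  rw [h4, orderOf_one] at h1
  exact hp.one_lt.ne h1

variable [T2Space G] [TotallyDisconnectedSpace G]

/-- If the pro-`p` torsion elements have finite conjugacy classes and form no nontrivial normal
subgroup, then some open normal subgroup has no nontrivial pro-`p` torsion elements. -/
theorem exists_isOpen_normal_forall_isProPTorsion_eq_one
    (hcore : ∀ B : Subgroup G, B.Normal → (∀ b ∈ B, IsProPTorsion p b) → B = ⊥)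
    (hC : ∀ g : G, IsProPTorsion p g → IsOpen (Subgroup.centralizer {g} : Set G)) :
    ∃ D : Subgroup G, D.Normal ∧ IsOpen (D : Set G) ∧ ∀ d ∈ D, IsProPTorsion p d → d = 1 := by
  obtain ⟨m, g, M, hg, hM, hMo, hm⟩ := exists_forall_index_centralizer_le hC
  -- u has the largest class among the `p`-elements of gM.
  obtain ⟨u, hu, huM, hmax⟩ : ∃ u, IsProPTorsion p u ∧ g⁻¹ * u ∈ M ∧
      ∀ v, IsProPTorsion p v → g⁻¹ * v ∈ M →
        (Subgroup.centralizer {v}).index ≤ (Subgroup.centralizer {u}).index := by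
    let S : Set ℕ := {n | ∃ u, IsProPTorsion p u ∧ g⁻¹ * u ∈ M ∧
      (Subgroup.centralizer {u}).index = n}
    have hS : BddAbove S := ⟨m, by rintro _ ⟨u, h1, h2, rfl⟩; exact hm u h1 h2⟩
    obtain ⟨u, h1, h2, h3⟩ := Nat.sSup_mem (s := S) ⟨_, g, hg, by simp, rfl⟩ hS
    exact ⟨u, h1, h2, fun v h4 h5 => h3 ▸ le_csSup hS ⟨v, h4, h5, rfl⟩⟩
  -- D is chosen inside M to centralize u and to separate u from its finitely many other conjugates.
  have hW : ((fun x => u⁻¹ * x) '' (Set.range fun y : G => y * u * y⁻¹) \ {1}).Finite :=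
    ((finite_range_conj (hC u hu)).image _).sdiff
  obtain ⟨N₁, hN₁, hN₁o, hN₁W⟩ := exists_isOpen_normal_subset hW.isClosed.isOpen_compl (by simp)
  obtain ⟨N₂, hN₂, hN₂o, hN₂C⟩ := exists_isOpen_normal_le (hC u hu)
  have hDn : (N₁ ⊓ N₂ ⊓ M).Normal := inferInstance
  have hDo : IsOpen ((N₁ ⊓ N₂ ⊓ M : Subgroup G) : Set G) := (hN₁o.inter hN₂o).inter hMo
  set D := N₁ ⊓ N₂ ⊓ M with hD
  have hDW : ∀ y : G, u⁻¹ * (y * u * y⁻¹) ∈ D → y * u * y⁻¹ = u := by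
    intro y hy
    by_contra hne
    refine hN₁W hy.1.1 ⟨⟨_, ⟨y, rfl⟩, rfl⟩, fun h => hne ?_⟩
    exact (inv_mul_eq_one.1 h).symm
  have hDC : D ≤ Subgroup.centralizer {u} := fun x hx => hN₂C hx.1.2
  have hcent : ∀ u' ∈ D, IsProPTorsion p u' → D ≤ Subgroup.centralizer {u'} := by
    intro u' hu'D hu'
    have hcomm : Commute u u' := (Subgroup.mem_centralizer_singleton_iff.1 (hDC hu'D)).symm
    have hv : IsProPTorsion p (u * u') := hu.mul hu' hcomm
    have hvM : g⁻¹ * (u * u') ∈ M := by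
      rw [← mul_assoc]; exact M.mul_mem huM hu'D.2
    -- If x fixes uu', then u⁻¹(xux⁻¹) = u'(xu'x⁻¹)⁻¹ lies in D, so x fixes u and hence u'. Thus
    -- C(uu') ≤ C(u), and maximality of the class of u forces equality, so D ≤ C(u) = C(uu') ≤
    -- C(u').
    have key : ∀ x ∈ Subgroup.centralizer {u * u'},
        x ∈ Subgroup.centralizer {u} ∧ x ∈ Subgroup.centralizer {u'} := by
      intro x hx
      rw [Subgroup.mem_centralizer_singleton_iff] at hx ⊢
      rw [Subgroup.mem_centralizer_singleton_iff]
      have h1 : u⁻¹ * (x * u * x⁻¹) = u' * (x * u' * x⁻¹)⁻¹ := by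
        have : x * (u * u') * x⁻¹ = u * u' := mul_inv_eq_iff_eq_mul.2 hx
        rw [inv_mul_eq_iff_eq_mul, ← mul_assoc, ← this]
        group
      have h2 := hDW x (h1 ▸ D.mul_mem hu'D (D.inv_mem (hDn.conj_mem _ hu'D x)))
      rw [h2, inv_mul_cancel, eq_comm, mul_inv_eq_one] at h1
      exact ⟨mul_inv_eq_iff_eq_mul.1 h2, mul_inv_eq_iff_eq_mul.1 h1.symm⟩
    have hle : Subgroup.centralizer {u * u'} ≤ Subgroup.centralizer {u} := fun x hx => (key x hx).1
    have hge : Subgroup.centralizer {u} ≤ Subgroup.centralizer {u * u'} := by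
      have := finite_quotient_of_isOpen (hC _ hv)
      have hne : (Subgroup.centralizer {u * u'}).index ≠ 0 := Subgroup.index_ne_zero_of_finite
      have hmul := Subgroup.relIndex_mul_index hle
      have hmx := hmax _ hv hvM
      rw [← Subgroup.relIndex_eq_one]
      rw [← hmul] at hmx hne
      have h0 := (mul_ne_zero_iff.1 hne).1
      have h1 := Nat.pos_of_ne_zero (mul_ne_zero_iff.1 hne).2
      have h2 : (Subgroup.centralizer {u * u'}).relIndex (Subgroup.centralizer {u}) ≤ 1 :=
        Nat.le_of_mul_le_mul_right (by simpa using hmx) h1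
      omega
    exact fun x hx => (key x (hge (hDC hx))).2
  refine ⟨D, hDn, hDo, fun d hd hdp => ?_⟩
  -- The `p`-elements of D commute with each other, so they form a normal subgroup.
  let B : Subgroup G :=
    { carrier := {x | x ∈ D ∧ IsProPTorsion p x}
      one_mem' := ⟨D.one_mem, isProPTorsion_one⟩
      mul_mem' := fun {a b} ha hb => ⟨D.mul_mem ha.1 hb.1, ha.2.mul hb.2
        (Subgroup.mem_centralizer_singleton_iff.1 (hcent b hb.1 hb.2 ha.1))⟩
      inv_mem' := fun {a} ha => ⟨D.inv_mem ha.1, ha.2.inv⟩ }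
  have hB : B = ⊥ := hcore B ⟨fun b hb x => ⟨hDn.conj_mem _ hb.1 x, hb.2.conj x⟩⟩
    fun b hb => hb.2
  have : d ∈ B := ⟨hd, hdp⟩
  rwa [hB, Subgroup.mem_bot] at this

/-- Coprime conjugacy gives a conjugator in each finite quotient; compactness makes one choice work
for all. -/
theorem exists_conj_eq_of_isProPTorsion [Fact p.Prime] {D : Subgroup G} (hDn : D.Normal)
    (hDo : IsOpen (D : Set G)) (hD : ∀ d ∈ D, IsProPTorsion p d → d = 1) {g g' : G}
    (hg : IsProPTorsion p g) (hg' : IsProPTorsion p g') (hgg' : g⁻¹ * g' ∈ D) :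
    ∃ d, g' = d * g * d⁻¹ := by
  suffices h : ∃ d : G, ∀ N : Subgroup G, N.Normal → IsOpen (N : Set G) →
      d ∈ {d : G | g'⁻¹ * (d * g * d⁻¹) ∈ N} by
    obtain ⟨d, hd⟩ := h
    exact ⟨d, inv_mul_eq_one.1 (eq_one_of_forall_mem_isOpen_normal hd)⟩
  refine exists_forall_isOpen_normal _ (fun N N' h x hx => h hx) ?_ ?_
  · intro N hN hNo
    exact (Subgroup.isClosed_of_isOpen N hNo).preimage (by fun_prop)
  · intro N hN hNo
    have := finite_quotient_of_isOpen hNo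
    have hmk : ∀ x : G, IsProPTorsion p x → ∃ k : ℕ, QuotientGroup.mk' N x ^ p ^ k = 1 := by
      intro x hx
      obtain ⟨k, hk⟩ := hx N hN hNo
      exact ⟨k, by rw [← map_pow]; exact (QuotientGroup.eq_one_iff _).2 hk⟩
    have : (D.map (QuotientGroup.mk' N)).Normal := hDn.map _ (QuotientGroup.mk'_surjective N)
    obtain ⟨_, ⟨d, _, rfl⟩, h⟩ := exists_conj_eq_of_coprime
      (not_dvd_card_map_mk hDn hDo hD N hNo) (hmk g hg) (hmk g' hg') ⟨_, hgg', by simp⟩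
    refine ⟨d, ?_⟩
    rw [← map_mul, ← map_inv, ← map_mul] at h
    exact QuotientGroup.eq.1 h

/-- If the pro-`p` torsion elements have finite conjugacy classes and form no nontrivial normal
subgroup, then they generate a finite normal subgroup. -/
theorem exists_finite_normal_of_isOpen_centralizer [Fact p.Prime]
    (hcore : ∀ B : Subgroup G, B.Normal → (∀ b ∈ B, IsProPTorsion p b) → B = ⊥)
    (hC : ∀ g : G, IsProPTorsion p g → IsOpen (Subgroup.centralizer {g} : Set G)) :
    ∃ N : Subgroup G, N.Normal ∧ Finite N ∧ ∀ g, IsProPTorsion p g → g ∈ N := by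
  obtain ⟨D, hDn, hDo, hD⟩ := exists_isOpen_normal_forall_isProPTorsion_eq_one hcore hC
  -- Finitely many cosets of D, each meeting at most one class of `p`-elements, which is finite.
  have hfin : {g : G | IsProPTorsion p g}.Finite := by
    have := finite_quotient_of_isOpen hDo
    refine Set.Finite.of_finite_fibers (QuotientGroup.mk : G → G ⧸ D) (Set.toFinite _) ?_
    rintro _ ⟨g, hg, rfl⟩
    refine (finite_range_conj (hC g hg)).subset ?_
    rintro g' ⟨hg', h⟩
    obtain ⟨d, rfl⟩ := exists_conj_eq_of_isProPTorsion hDn hDo hD hg hg'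
      (QuotientGroup.eq.1 (Eq.symm h))
    exact ⟨d, rfl⟩
  refine ⟨Subgroup.closure {g : G | IsProPTorsion p g}, ?_,
    finite_closure_of_finite_of_isOfFinOrder hfin (fun t ht x => ht.conj x) fun t ht => ?_,
    fun g hg => Subgroup.subset_closure hg⟩
  · rw [← Subgroup.normalizer_eq_top_iff, eq_top_iff]
    refine le_trans (fun x _ => ?_) (Subgroup.normalizer_le_normalizer_closure _)
    have := hfin.to_subtype
    exact Subgroup.mem_normalizer_fintype fun n hn => IsProPTorsion.conj hn x
  · obtain ⟨k, hk⟩ := ht D hDn hDo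
    exact isOfFinOrder_iff_pow_eq_one.2
      ⟨p ^ k, pow_pos (Fact.out : p.Prime).pos k, hD _ hk (IsProPTorsion.pow ht _)⟩

end TrivialPCore

/-! ### The profinite `p`-core and the quotient by it -/

section ProfinitePCore

variable {G : Type*} [Group G] [TopologicalSpace G] {p : ℕ}

/-- The largest closed normal pro-`p` subgroup of a profinite group. -/
def profinitePCore (p : ℕ) (G : Type*) [Group G] [TopologicalSpace G] : Subgroup G where
  carrier := {x | ∀ (N : Subgroup G) (_ : N.Normal), IsOpen (N : Set G) →
    QuotientGroup.mk' N x ∈ pCore p (G ⧸ N)}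
  one_mem' := fun N _ _ => by rw [map_one]; exact Subgroup.one_mem _
  mul_mem' := fun ha hb N hN hNo => by
    rw [map_mul]; exact Subgroup.mul_mem _ (ha N hN hNo) (hb N hN hNo)
  inv_mem' := fun ha N hN hNo => by rw [map_inv]; exact Subgroup.inv_mem _ (ha N hN hNo)

theorem mem_profinitePCore {x : G} : x ∈ profinitePCore p G ↔
    ∀ (N : Subgroup G) (_ : N.Normal), IsOpen (N : Set G) →
      QuotientGroup.mk' N x ∈ pCore p (G ⧸ N) := Iff.rfl

instance profinitePCore_normal : (profinitePCore p G).Normal :=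
  ⟨fun x hx y N hN hNo => by
    rw [map_mul, map_mul, map_inv]
    exact Subgroup.Normal.conj_mem inferInstance _ (hx N hN hNo) _⟩

theorem isProPTorsion_of_mem_profinitePCore {x : G} (hx : x ∈ profinitePCore p G) :
    IsProPTorsion p x := by
  intro N hN hNo
  obtain ⟨k, hk⟩ := isPGroup_pCore ⟨_, hx N hN hNo⟩
  exact ⟨k, (QuotientGroup.eq_one_iff _).1 (congrArg Subtype.val hk)⟩

theorem le_profinitePCore {B : Subgroup G} (hB : B.Normal) (h : ∀ b ∈ B, IsProPTorsion p b) :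
    B ≤ profinitePCore p G := by
  intro b hb N hN hNo
  refine ⟨B.map (QuotientGroup.mk' N), hB.map _ (QuotientGroup.mk'_surjective N), ?_,
    Subgroup.mem_map_of_mem _ hb⟩
  rintro ⟨y, hy⟩
  obtain ⟨c, hc, rfl⟩ := Subgroup.mem_map.1 hy
  obtain ⟨k, hk⟩ := h c hc N hN hNo
  exact ⟨k, Subtype.ext ((QuotientGroup.eq_one_iff _).2 hk)⟩

theorem IsProPTorsion.mk {g : G} (hg : IsProPTorsion p g) (A : Subgroup G) [A.Normal] :
    IsProPTorsion p (g : G ⧸ A) := by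
  intro N hN hNo
  obtain ⟨k, hk⟩ := hg (N.comap (QuotientGroup.mk' A)) (hN.comap _)
    (hNo.preimage QuotientGroup.continuous_mk)
  exact ⟨k, hk⟩

variable [IsTopologicalGroup G]

theorem isOpen_centralizer_mk {g : G} (A M : Subgroup G) [A.Normal] (hMo : IsOpen (M : Set G))
    (h : ∀ x ∈ M, x⁻¹ * g⁻¹ * x * g ∈ A) :
    IsOpen (Subgroup.centralizer {(g : G ⧸ A)} : Set (G ⧸ A)) := by
  refine Subgroup.isOpen_mono (H₁ := M.map (QuotientGroup.mk' A)) ?_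
    (QuotientGroup.isOpenMap_coe _ hMo)
  rintro _ ⟨x, hx, rfl⟩
  rw [Subgroup.mem_centralizer_singleton_iff]
  have h1 : ((g * x : G) : G ⧸ A) = (x * g : G) := QuotientGroup.eq.2 (by
    simpa [mul_assoc] using h x hx)
  exact h1.symm

theorem isClosed_profinitePCore : IsClosed (profinitePCore p G : Set G) := by
  have : (profinitePCore p G : Set G) = ⋂ (N : Subgroup G) (_ : N.Normal)
      (_ : IsOpen (N : Set G)), (QuotientGroup.mk : G → G ⧸ N) ⁻¹' (pCore p (G ⧸ N)) := by
    ext x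
    simp only [SetLike.mem_coe, mem_profinitePCore, Set.mem_iInter]
    rfl
  rw [this]
  exact isClosed_iInter fun N => isClosed_iInter fun hN => isClosed_iInter fun hNo =>
    (isClopen_preimage_mk hNo _).isClosed

/-- Pro-`p` by pro-`p` is pro-`p`: the exponents add up. So the `p`-elements of the quotient come
from those of G, and the quotient has trivial core. -/
theorem IsProPTorsion.of_mk {g : G} (hg : IsProPTorsion p (g : G ⧸ profinitePCore p G)) :
    IsProPTorsion p g := by
  intro N hN hNo
  obtain ⟨k, hk⟩ := hg (N.map (QuotientGroup.mk' (profinitePCore p G)))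
    (hN.map _ (QuotientGroup.mk'_surjective _)) (QuotientGroup.isOpenMap_coe _ hNo)
  obtain ⟨n, hn, hng⟩ := hk
  have h1 : n⁻¹ * g ^ p ^ k ∈ profinitePCore p G := QuotientGroup.eq.1 hng
  obtain ⟨l, hl⟩ := isPGroup_pCore ⟨_, h1 N hN hNo⟩
  have h2 : QuotientGroup.mk' N (n⁻¹ * g ^ p ^ k) = QuotientGroup.mk' N (g ^ p ^ k) := by
    have hn1 : QuotientGroup.mk' N n = 1 := (QuotientGroup.eq_one_iff n).2 hn
    rw [map_mul, map_inv, hn1, inv_one, one_mul]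
  have h3 : QuotientGroup.mk' N (n⁻¹ * g ^ p ^ k) ^ p ^ l = 1 := congrArg Subtype.val hl
  rw [h2, ← map_pow, ← pow_mul, ← pow_add] at h3
  exact ⟨k + l, (QuotientGroup.eq_one_iff _).1 h3⟩

theorem eq_bot_of_forall_isProPTorsion_quotient {B : Subgroup (G ⧸ profinitePCore p G)}
    (hB : B.Normal) (h : ∀ b ∈ B, IsProPTorsion p b) : B = ⊥ := by
  have h1 : B.comap (QuotientGroup.mk' _) ≤ profinitePCore p G :=
    le_profinitePCore (hB.comap _) fun b hb => IsProPTorsion.of_mk (h _ hb)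
  rw [eq_bot_iff]
  intro b hb
  obtain ⟨x, rfl⟩ := QuotientGroup.mk_surjective b
  exact (QuotientGroup.eq_one_iff x).2 (h1 hb)

variable [CompactSpace G] [TotallyDisconnectedSpace G]

/-- A pro-`p` torsion element with a finite Engel sink centralizes an open normal subgroup
modulo the largest normal pro-`p` subgroup. -/
theorem exists_commutator_mem_profinitePCore [Fact p.Prime] {g : G} (hg : IsProPTorsion p g)
    {E : Set G} (hE : E.Finite) (hsink : IsEngelSink g E) :
    ∃ M : Subgroup G, M.Normal ∧ IsOpen (M : Set G) ∧
      ∀ x ∈ M, x⁻¹ * g⁻¹ * x * g ∈ profinitePCore p G := by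
  -- For x in M all [x, ₙg] stay in M, which meets E in at most 1, so they are eventually trivial.
  obtain ⟨M, hM, hMo, hME⟩ := exists_isOpen_normal_subset (U := (E \ {1})ᶜ)
    hE.sdiff.isClosed.isOpen_compl (by simp)
  refine ⟨M, hM, hMo, fun x hx N hN hNo => ?_⟩
  have := finite_quotient_of_isOpen hNo
  have : (M.map (QuotientGroup.mk' N)).Normal := hM.map _ (QuotientGroup.mk'_surjective N)
  simp only [map_mul, map_inv]
  refine commutator_mem_pCore_of_engel (M := M.map (QuotientGroup.mk' N)) ?_ ?_
    (Subgroup.mem_map_of_mem _ hx)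
  · obtain ⟨k, hk⟩ := hg N hN hNo
    exact ⟨k, by rw [← map_pow]; exact (QuotientGroup.eq_one_iff _).2 hk⟩
  · intro y hy
    obtain ⟨z, hz, rfl⟩ := Subgroup.mem_map.1 hy
    obtain ⟨l, _, hl⟩ := hsink z
    refine ⟨l, ?_⟩
    rw [← map_engelCommutator]
    have h1 : engelCommutator z g l = 1 := by
      by_contra hne
      exact hME (engelCommutator_mem_of_normal hz l) ⟨hl l le_rfl, hne⟩
    rw [h1, map_one]

/-- If a⁻¹b ∉ A, some open normal N has a⁻¹bN disjoint from A; then a and b lie in different cosets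
of the open subgroup NA/A, and such cosets are clopen. -/
theorem isProfiniteGroup_quotient {A : Subgroup G} [A.Normal] (hA : IsClosed (A : Set G)) :
    IsProfiniteGroup (G ⧸ A) := by
  suffices TotallySeparatedSpace (G ⧸ A) from
    ⟨inferInstance, inferInstance, inferInstance, inferInstance⟩
  refine totallySeparatedSpace_iff_exists_isClopen.2 ?_
  intro x y hxy
  obtain ⟨a, rfl⟩ := QuotientGroup.mk_surjective x
  obtain ⟨b, rfl⟩ := QuotientGroup.mk_surjective y
  have hab : a⁻¹ * b ∉ A := fun h => hxy (QuotientGroup.eq.2 h)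
  obtain ⟨N, hN, hNo, hNA⟩ := exists_isOpen_normal_subset (U := {x | a⁻¹ * b * x ∈ (A : Set G)ᶜ})
    (hA.isOpen_compl.preimage (continuous_const_mul _)) (by simpa using hab)
  have hMo : IsOpen (N.map (QuotientGroup.mk' A) : Set (G ⧸ A)) := QuotientGroup.isOpenMap_coe _ hNo
  refine ⟨{z | (a : G ⧸ A)⁻¹ * z ∈ N.map (QuotientGroup.mk' A)},
    IsClopen.preimage ⟨Subgroup.isClosed_of_isOpen _ hMo, hMo⟩ (continuous_const_mul _), ?_, ?_⟩
  · show (a : G ⧸ A)⁻¹ * a ∈ N.map (QuotientGroup.mk' A)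
    rw [inv_mul_cancel]; exact Subgroup.one_mem _
  · rintro ⟨n, hn, h⟩
    have h1 : n⁻¹ * (a⁻¹ * b) ∈ A := QuotientGroup.eq.1 h
    have h2 : a⁻¹ * b * n⁻¹ ∈ A := by
      have := Subgroup.Normal.conj_mem (inferInstance : A.Normal) _ h1 n
      simpa using this
    exact hNA (N.inv_mem hn) h2

/-- By Cauchy, a bad finite quotient has an element of order `p`; it lifts to a pro-`p` torsion
element of G, which dies in G/N. -/
theorem isProPPrime_quotient [Fact p.Prime] {N : Subgroup G} [N.Normal] (hN : IsClosed (N : Set G))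
    (h : ∀ g, IsProPTorsion p g → g ∈ N) : IsProPPrime p (G ⧸ N) := by
  refine ⟨isProfiniteGroup_quotient hN, fun U _ hUo => ?_⟩
  have hp : p.Prime := Fact.out
  rw [Nat.Prime.coprime_iff_not_dvd hp]
  intro hdvd
  have := finite_quotient_of_isOpen hUo
  obtain ⟨y, hy⟩ := exists_prime_orderOf_dvd_card' p hdvd
  obtain ⟨x, rfl⟩ := QuotientGroup.mk_surjective y
  obtain ⟨g, rfl⟩ := QuotientGroup.mk_surjective x
  let f : G →* (G ⧸ N) ⧸ U := (QuotientGroup.mk' U).comp (QuotientGroup.mk' N)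
  have hfo : IsOpen (f.ker : Set G) := by
    have : (f.ker : Set G) = (QuotientGroup.mk : G → G ⧸ N) ⁻¹' U := by
      ext z
      exact QuotientGroup.eq_one_iff _
    rw [this]
    exact hUo.preimage QuotientGroup.continuous_mk
  have hfg : orderOf (f g) = p := hy
  obtain ⟨g', hg', hgg'⟩ := exists_isProPTorsion_of_pow_mem (k := 1) (d := g) hp
    (inferInstance : f.ker.Normal) hfo (by
      rw [pow_one, MonoidHom.mem_ker, map_pow]
      exact orderOf_dvd_iff_pow_eq_one.1 hfg.dvd)
  have h1 : f g' = 1 := by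
    have : QuotientGroup.mk' N g' = 1 := (QuotientGroup.eq_one_iff _).2 (h g' hg')
    simp only [f, MonoidHom.comp_apply, this, map_one]
  rw [MonoidHom.mem_ker, map_mul, map_inv, h1, mul_one, inv_eq_one] at hgg'
  rw [hgg', orderOf_one] at hfg
  exact hp.one_lt.ne hfg

variable [T2Space G]

theorem isVirtuallyProP_of_finiteIndex {A N : Subgroup G} (hA : IsClosed (A : Set G))
    (hAp : ∀ a ∈ A, IsProPTorsion p a) (hN : IsClosed (N : Set G))
    (hfin : (A.subgroupOf N).FiniteIndex) : IsVirtuallyProP p N := by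
  have hc : CompactSpace N := isCompact_iff_compactSpace.1 hN.isCompact
  have hcl : IsClosed (A.subgroupOf N : Set N) := hA.preimage continuous_subtype_val
  refine ⟨⟨inferInstance, hc, inferInstance, inferInstance⟩, A.subgroupOf N,
    Subgroup.isOpen_of_isClosed_of_finiteIndex _ hcl, ?_⟩
  refine isProP_of_forall_isProPTorsion hcl fun b hb U hU hUo => ?_
  obtain ⟨V, hV, hVU⟩ := isOpen_induced_iff.1 hUo
  have h1 : (1 : N) ∈ Subtype.val ⁻¹' V := hVU ▸ U.one_mem
  obtain ⟨W, hW, hWo, hWV⟩ := exists_isOpen_normal_subset hV h1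
  obtain ⟨k, hk⟩ := hAp b hb W hW hWo
  refine ⟨k, ?_⟩
  rw [← SetLike.mem_coe, ← hVU]
  exact hWV hk

end ProfinitePCore

theorem theorem1p2 {G : Type*} [Group G] [TopologicalSpace G] [IsTopologicalGroup G]
    [CompactSpace G] [T2Space G] [TotallyDisconnectedSpace G] (p : ℕ) (hp : p.Prime)
    (h : ∀ g : G, IsPElement p g → ∃ E : Set G, E.Finite ∧ IsEngelSink g E) :
    ∃ (N : Subgroup G) (_ : N.Normal), IsClosed (N : Set G) ∧
      IsVirtuallyProP p N ∧ IsProPPrime p (G ⧸ N) := by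
  have : Fact p.Prime := ⟨hp⟩
  set A := profinitePCore p G with hA
  have hAc : IsClosed (A : Set G) := isClosed_profinitePCore
  obtain ⟨_, _, _, _⟩ := isProfiniteGroup_quotient hAc
  obtain ⟨N, hNn, hNf, hN⟩ := exists_finite_normal_of_isOpen_centralizer (G := G ⧸ A) (p := p)
    (fun B hB hBp => eq_bot_of_forall_isProPTorsion_quotient hB hBp) (fun x hx => by
      obtain ⟨g, rfl⟩ := QuotientGroup.mk_surjective x
      have hg : IsProPTorsion p g := IsProPTorsion.of_mk hx
      obtain ⟨E, hE, hsink⟩ := h g hg.isPElement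
      obtain ⟨M, _, hMo, hM⟩ := exists_commutator_mem_profinitePCore hg hE hsink
      exact isOpen_centralizer_mk A M hMo hM)
  have hNc : IsClosed (N.comap (QuotientGroup.mk' A) : Set G) :=
    (Set.toFinite (N : Set (G ⧸ A))).isClosed.preimage QuotientGroup.continuous_mk
  have hnorm : (N.comap (QuotientGroup.mk' A)).Normal := hNn.comap _
  refine ⟨N.comap (QuotientGroup.mk' A), hnorm, hNc, ?_, ?_⟩
  · refine isVirtuallyProP_of_finiteIndex hAc (fun a ha => isProPTorsion_of_mem_profinitePCore ha)
      hNc ?_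
    let φ : N.comap (QuotientGroup.mk' A) →* N := (QuotientGroup.mk' A).subgroupComap N
    -- The map onto the finite subgroup of G/A has kernel inside A, so A has finite index in the
    -- preimage.
    refine Subgroup.finiteIndex_of_le (H := φ.ker) fun x hx => ?_
    exact (QuotientGroup.eq_one_iff (x : G)).1 (congrArg Subtype.val (MonoidHom.mem_ker.1 hx))
  · exact isProPPrime_quotient hNc fun g hg => hN _ (hg.mk A)
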